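/- Let $(W,S)$ be a Coxeter system with $S$ finite ($W$ possibly infinite). Let $\bar S$ be the set of equivalence classes of $S$ under conjugacy in $W$, and let $\Lambda=\mathbb Z[\bar S]$ be the free abelian group with basis $\bar S$. **Cells.** For a totally ordered abelian group $\Gamma$ and a map $\varphi:\bar S\to\Gamma$, let $\mathcal H(W,S,\varphi)$ be the Hecke algebra with parameter $\varphi$: the $\mathbb Z[\Gamma]$-algebra, free over $\mathbb Z[\Gamma]=\bigoplus_\gamma\mathbb Z e^\gamma$ with basis $(T_w)_{w\in W}$, with $T_wT_{w'}=T_{ww'}$ whenever $\ell(ww')=\ell(w)+\ell(w')$ and $(T_s-e^{\varphi(s)})(T_s+e^{-\varphi(s)})=0$ for $s\in S$. Its bar involution is the ring automorphism with $\overline{e^\gamma}=e^{-\gamma}$ and $\overline{T_w}=T_{w^{-1}}^{-1}$, and $(C_w)_{w\in W}$ is its Kazhdan–Lusztig basis: $C_w$ is the unique element with $\overline{C_w}=C_w$ and $C_w\equiv T_w$ modulo $\bigoplus_{x\in W}\bigl(\bigoplus_{\gamma<0}\mathbb Z e^{\gamma}\bigr)T_x$. Write $x\leftarrow_L y$ (resp.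 $x\leftarrow_R y$, resp. $x\leftarrow_{LR}y$) if there is $h\in\mathcal H(W,S,\varphi)$ such that $C_x$ has a non-zero coefficient in the expansion of $hC_y$ (resp. of $C_yh$, resp. of $hC_y$ or of $C_yh$) in the Kazhdan–Lusztig basis. For $?\in\{L,R,LR\}$ let $\leqslant_?^\varphi$ be the transitive closure of $\leftarrow_?$ (a preorder), and $\sim_?^\varphi$ the associated equivalence relation on $W$; its classes are the $?$-cells. **Positive subsets.** A subset $X\subseteq\Lambda$ is positive if $\Lambda=X\cup(-X)$, $X+X\subseteq X$ and $X\cap(-X)$ is a subgroup. Let $\mathcal Pos(\Lambda)$ be the set of positive subsets. For $E\subseteq\Lambda$ put $\mathcal U(E)=\{X\in\mathcal Pos(\Lambda): X\cap E=\varnothing\}$; a subset $\mathcal V$ of $\mathcal Pos(\Lambda)$ is open if for every $X\in\mathcal V$ there is a finite $E\subseteq\Lambda$ with $X\in\mathcal U(E)\subseteq\mathcal V$. For $X\in\mathcal Pos(\Lambda)$ let $\Gamma_X=\Lambda/(X\cap(-X))$, totally ordered by: $\gamma\le\gamma'$ if and only if $\gamma'-\gamma$ has a representative in $X$. Let $\varphi_X:\bar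 S\to\Gamma_X$ be the canonical map, and set $\sim_?^X\,=\,\sim_?^{\varphi_X}$ and $\mathrm{Cell}_?^X(w)=\{x\in W: x\sim_?^X w\}$. **Arrangements.** For $\lambda\in\Lambda\setminus\{0\}$, the rational hyperplane $\mathcal H_\lambda$ is $\{X\in\mathcal Pos(\Lambda):\lambda\in X\cap(-X)\}$. The space $\mathcal Pos(\Lambda)$ is the disjoint union of $\mathcal U(\{\lambda\})$, $\mathcal H_\lambda$ and $\mathcal U(\{-\lambda\})$, and this partition depends only on the hyperplane. For a finite set $\mathfrak A$ of rational hyperplanes, the $\mathfrak A$-facets are the classes of the equivalence relation "for every hyperplane in $\mathfrak A$, $X$ and $Y$ lie in the same part of this partition"; the $\mathfrak A$-chambers are the facets that meet no member of $\mathfrak A$. The arrangement $\mathfrak A$ is complete if $\mathcal H_\omega\in\mathfrak A$ for all $\omega\in\bar S$. For a facet $\mathcal F$, let $W_{\mathcal F}$ be the subgroup of $W$ generated by the $s\in S$ whose class $\omega$ satisfies $\mathcal F\subseteq\mathcal H_\omega$. **Conjecture A for $(W,S)$.** There is a finite complete rational hyperplane arrangement $\mathfrak A$ in $\mathcal Pos(\Lambda)$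 such that, for all $?\in\{L,R,LR\}$: (a) if $X$ and $Y$ belong to the same $\mathfrak A$-facet $\mathcal F$, then $\sim_?^X\,=\,\sim_?^Y$ (denote this relation by $\sim_?^{\mathcal F}$); (b) for every $\mathfrak A$-facet $\mathcal F$, the classes of $\sim_?^{\mathcal F}$ are the minimal non-empty subsets $C$ of $W$ such that (b1) for every chamber $\mathcal C$ with $\mathcal F\subseteq\overline{\mathcal C}$, $C$ is a union of classes of $\sim_?^{\mathcal C}$, and (b2) $C$ is stable under translation by $W_{\mathcal F}$ (on the left if $?=L$, on the right if $?=R$, on both sides if $?=LR$). A map $\xi$ from a topological space $\mathcal X$ to a partially ordered set $P$ is called upper semicontinuous if $\{x\in\mathcal X:\xi(x)<p\}$ is open for every $p\in P$. **Theorem.** Suppose that Conjecture A holds for $(W,S)$. Then: 1. for every $?\in\{L,R,LR\}$, the map $X\mapsto\,\sim_?^X$ from $\mathcal Pos(\mathbb Z[\bar S])$ to the lattice of equivalence relations on $W$, ordered by $\mathcal R\preccurlyeq\mathcal R'$ if and only if $x\,\mathcal R\,y$ implies $x\,\mathcal R'\,y$, is upper semicontinuous; 2. for every $?\in\{L,R,LR\}$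 and every $w\in W$, the map $X\mapsto\mathrm{Cell}_?^X(w)$ from $\mathcal Pos(\mathbb Z[\bar S])$ to the power set of $W$, ordered by inclusion, is upper semicontinuous. -/

import Mathlib

open Set Topology

noncomputable section

namespace KLCells

/-! ## Positive subsets of an abelian group -/

section Positive

/-- A subset `X` of an abelian group with `Λ = X ∪ (-X)`, `X + X ⊆ X`, and such that
`X ∩ (-X)` is a subgroup. -/
@[ext]
structure PositiveSubset (Λ : Type*) [AddCommGroup Λ] where
  carrier : Set Λ
  union_neg : ∀ a : Λ, a ∈ carrier ∨ -a ∈ carrier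
  add_mem : ∀ a ∈ carrier, ∀ b ∈ carrier, a + b ∈ carrier
  inter_neg : ∃ H : AddSubgroup Λ, (H : Set Λ) = {a | a ∈ carrier ∧ -a ∈ carrier}

variable {Λ : Type*} [AddCommGroup Λ]

/-- `U E` is the set of positive subsets that are disjoint from `E`. -/
def U (E : Set Λ) : Set (PositiveSubset Λ) := {X | X.carrier ∩ E = ∅}

theorem U_union (E F : Set Λ) : U (E ∪ F) = U E ∩ U F := by
  ext X
  simp only [U, mem_ofPred_eq, mem_inter_iff, inter_union_distrib_left, union_empty_iff]

/-- A set `V` of positive subsets is open if every `X ∈ V` has a finite `E ⊆ Λ` with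
`X ∈ U E ⊆ V`. -/
instance : TopologicalSpace (PositiveSubset Λ) where
  IsOpen V := ∀ X ∈ V, ∃ E : Set Λ, E.Finite ∧ X ∈ U E ∧ U E ⊆ V
  isOpen_univ := fun X _ => ⟨∅, finite_empty, by simp [U], subset_univ _⟩
  isOpen_inter := by
    rintro V V' hV hV' X ⟨hX, hX'⟩
    obtain ⟨E, hE, hXE, hEV⟩ := hV X hX
    obtain ⟨F, hF, hXF, hFV⟩ := hV' X hX'
    refine ⟨E ∪ F, hE.union hF, ?_, ?_⟩
    · rw [U_union]; exact ⟨hXE, hXF⟩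
    · rw [U_union]; exact inter_subset_inter hEV hFV
  isOpen_sUnion := by
    rintro 𝒱 h𝒱 X ⟨V, hV, hXV⟩
    obtain ⟨E, hE, hXE, hEV⟩ := h𝒱 V hV X hXV
    exact ⟨E, hE, hXE, hEV.trans (subset_sUnion_of_mem hV)⟩

/-- The rational hyperplane attached to `a` (meant for `a ≠ 0`): the set of positive subsets
`X` with `a ∈ X ∩ (-X)`. -/
def hyperplane (a : Λ) : Set (PositiveSubset Λ) := {X | a ∈ X.carrier ∧ -a ∈ X.carrier}

/-- A rational hyperplane arrangement: a set of rational hyperplanes. -/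
def IsArrangement (𝔄 : Set (Set (PositiveSubset Λ))) : Prop :=
  ∀ P ∈ 𝔄, ∃ a : Λ, a ≠ 0 ∧ P = hyperplane a

/-- The relation defined by a rational hyperplane `P = hyperplane a`: its classes are `U {a}`,
`P` and `U {-a}`. They do not depend on the choice of `a`, so all choices are taken at once. -/
def SameSide (P : Set (PositiveSubset Λ)) (X Y : PositiveSubset Λ) : Prop :=
  ∀ a : Λ, a ≠ 0 → P = hyperplane a →
    (X ∈ U {a} ↔ Y ∈ U {a}) ∧ (X ∈ P ↔ Y ∈ P) ∧ (X ∈ U {-a} ↔ Y ∈ U {-a})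

/-- `X` and `Y` are on the same side of every hyperplane of the arrangement. -/
def facetSetoid (𝔄 : Set (Set (PositiveSubset Λ))) : Setoid (PositiveSubset Λ) where
  r X Y := ∀ P ∈ 𝔄, SameSide P X Y
  iseqv :=
    { refl := fun _ _ _ _ _ _ => ⟨Iff.rfl, Iff.rfl, Iff.rfl⟩
      symm := fun h P hP a ha hPa =>
        ⟨(h P hP a ha hPa).1.symm, (h P hP a ha hPa).2.1.symm, (h P hP a ha hPa).2.2.symm⟩
      trans := fun h h' P hP a ha hPa =>
        ⟨(h P hP a ha hPa).1.trans (h' P hP a ha hPa).1,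
          (h P hP a ha hPa).2.1.trans (h' P hP a ha hPa).2.1,
          (h P hP a ha hPa).2.2.trans (h' P hP a ha hPa).2.2⟩ }

/-- Facets are the equivalence classes of `facetSetoid 𝔄`. -/
def IsFacet (𝔄 : Set (Set (PositiveSubset Λ))) (F : Set (PositiveSubset Λ)) : Prop :=
  F ∈ (facetSetoid 𝔄).classes

/-- Chambers are the facets that meet no hyperplane of the arrangement. -/
def IsChamber (𝔄 : Set (Set (PositiveSubset Λ))) (C : Set (PositiveSubset Λ)) : Prop :=
  IsFacet 𝔄 C ∧ ∀ P ∈ 𝔄, C ∩ P = ∅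

namespace PositiveSubset

variable (X : PositiveSubset Λ)

theorem zero_mem : (0 : Λ) ∈ X.carrier := by
  rcases X.union_neg 0 with h | h <;> simpa using h

/-- The subgroup `X ∩ (-X)`. -/
def ker : AddSubgroup Λ where
  carrier := {a | a ∈ X.carrier ∧ -a ∈ X.carrier}
  add_mem' := by
    rintro a b ⟨ha, ha'⟩ ⟨hb, hb'⟩
    refine ⟨X.add_mem a ha b hb, ?_⟩
    rw [neg_add]
    exact X.add_mem _ ha' _ hb'
  zero_mem' := ⟨X.zero_mem, by simpa using X.zero_mem⟩
  neg_mem' := by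
    rintro a ⟨ha, ha'⟩
    exact ⟨ha', by simpa using ha⟩

/-- The quotient group `Γ_X = Λ / (X ∩ (-X))`. -/
def Gam : Type _ := Λ ⧸ X.ker

instance : AddCommGroup X.Gam := inferInstanceAs (AddCommGroup (Λ ⧸ X.ker))

/-- The canonical morphism `Λ → Γ_X`. -/
def can : Λ →+ X.Gam := QuotientAddGroup.mk' X.ker

theorem can_surjective : Function.Surjective X.can := QuotientAddGroup.mk'_surjective X.ker

theorem can_eq_iff {a b : Λ} : X.can a = X.can b ↔ b - a ∈ X.ker := by
  have h : X.can a = X.can b ↔ -a + b ∈ X.ker := QuotientAddGroup.eq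
  rw [h, neg_add_eq_sub]

/-- `γ ≤ δ` if some representative of `δ - γ` belongs to `X`. -/
instance : LE X.Gam := ⟨fun γ δ => ∃ a ∈ X.carrier, X.can a = δ - γ⟩

theorem gam_le_def {γ δ : X.Gam} : γ ≤ δ ↔ ∃ a ∈ X.carrier, X.can a = δ - γ := Iff.rfl

theorem can_le_can {a b : Λ} : X.can a ≤ X.can b ↔ b - a ∈ X.carrier := by
  rw [gam_le_def]
  constructor
  · rintro ⟨c, hc, h⟩
    rw [← map_sub, can_eq_iff] at h
    have := X.add_mem _ h.1 _ hc
    simpa using this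
  · intro h
    exact ⟨b - a, h, map_sub _ _ _⟩

instance : LinearOrder X.Gam where
  le_refl γ := ⟨0, X.zero_mem, by simp⟩
  le_trans γ δ ε h h' := by
    obtain ⟨a, rfl⟩ := X.can_surjective γ
    obtain ⟨b, rfl⟩ := X.can_surjective δ
    obtain ⟨c, rfl⟩ := X.can_surjective ε
    rw [can_le_can] at *
    simpa using X.add_mem _ h' _ h
  le_antisymm γ δ h h' := by
    obtain ⟨a, rfl⟩ := X.can_surjective γ
    obtain ⟨b, rfl⟩ := X.can_surjective δ
    rw [can_le_can] at *
    rw [can_eq_iff]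
    exact ⟨h, by simpa using h'⟩
  le_total γ δ := by
    obtain ⟨a, rfl⟩ := X.can_surjective γ
    obtain ⟨b, rfl⟩ := X.can_surjective δ
    simp only [can_le_can]
    simpa using X.union_neg (b - a)
  toDecidableLE := Classical.decRel _

instance : IsOrderedAddMonoid X.Gam where
  add_le_add_left γ δ h ε := by
    obtain ⟨a, rfl⟩ := X.can_surjective γ
    obtain ⟨b, rfl⟩ := X.can_surjective δ
    obtain ⟨c, rfl⟩ := X.can_surjective ε
    rw [← map_add, ← map_add]
    rw [can_le_can] at *
    simpa using h

end PositiveSubset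

end Positive

/-! ## Hecke algebras with unequal parameters -/

section Hecke

variable {B W : Type*} [Group W] {M : CoxeterMatrix B} (cs : CoxeterSystem M W)

/-- Conjugacy in `W` of simple reflections. -/
def conjSetoid : Setoid B := (IsConj.setoid W).comap cs.simple

/-- The set of `W`-conjugacy classes of simple reflections. -/
def SBar : Type _ := Quotient (conjSetoid cs)

/-- The class of a simple reflection. -/
def cls (i : B) : SBar cs := Quotient.mk (conjSetoid cs) i

instance [Finite B] : Finite (SBar cs) := inferInstanceAs (Finite (Quotient _))

variable {Γ : Type*} [AddCommGroup Γ]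

/-- The group algebra `ℤ[Γ]`. -/
abbrev Coef (Γ : Type*) [AddCommGroup Γ] : Type _ := AddMonoidAlgebra ℤ Γ

/-- The element `e^γ` of `ℤ[Γ]`. -/
def ex (γ : Γ) : Coef Γ := AddMonoidAlgebra.single γ 1

theorem ex_add (γ δ : Γ) : ex (γ + δ) = ex γ * ex δ := by
  simp [ex, AddMonoidAlgebra.single_mul_single]

theorem ex_zero : ex (0 : Γ) = 1 := rfl

/-- The involution of `ℤ[Γ]` sending `e^γ` to `e^(-γ)`. -/
def barCoef : Coef Γ →+* Coef Γ := AddMonoidAlgebra.mapDomainRingHom ℤ (negAddMonoidHom : Γ →+ Γ)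

theorem barCoef_ex (γ : Γ) : barCoef (ex γ) = ex (-γ) := by
  simp [barCoef, ex]

variable (φ : SBar cs → Γ)

/-- The defining relations of the Hecke algebra with parameter `φ`, on generators indexed
by `W`. -/
inductive HeckeRel : FreeAlgebra (Coef Γ) W → FreeAlgebra (Coef Γ) W → Prop
  | one : HeckeRel (FreeAlgebra.ι (Coef Γ) 1) 1
  | mul (w w' : W) (h : cs.length (w * w') = cs.length w + cs.length w') :
      HeckeRel (FreeAlgebra.ι (Coef Γ) w * FreeAlgebra.ι (Coef Γ) w')
        (FreeAlgebra.ι (Coef Γ) (w * w'))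
  | quad (i : B) :
      HeckeRel
        ((FreeAlgebra.ι (Coef Γ) (cs.simple i) - algebraMap (Coef Γ) _ (ex (φ (cls cs i)))) *
          (FreeAlgebra.ι (Coef Γ) (cs.simple i) + algebraMap (Coef Γ) _ (ex (-φ (cls cs i))))) 0

/-- The Hecke algebra with parameter `φ`: the unital `ℤ[Γ]`-algebra generated by the `T_w`,
subject to `T_1 = 1`, to `T_w T_w' = T_{ww'}` if the lengths add up, and to
`(T_s - e^φ(s)) (T_s + e^(-φ(s))) = 0`. It is free over `ℤ[Γ]` with basis `(T_w)`. -/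
def Hecke : Type _ := RingQuot (HeckeRel cs φ)

instance : Ring (Hecke cs φ) := inferInstanceAs (Ring (RingQuot (HeckeRel cs φ)))

instance : Algebra (Coef Γ) (Hecke cs φ) :=
  inferInstanceAs (Algebra (Coef Γ) (RingQuot (HeckeRel cs φ)))

/-- The projection from the free algebra. -/
def proj : FreeAlgebra (Coef Γ) W →ₐ[Coef Γ] Hecke cs φ :=
  RingQuot.mkAlgHom (Coef Γ) (HeckeRel cs φ)

/-- The standard basis element `T_w`. -/
def T (w : W) : Hecke cs φ := proj cs φ (FreeAlgebra.ι (Coef Γ) w)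

/-- The image of `e^γ` in the Hecke algebra. -/
def exH (γ : Γ) : Hecke cs φ := algebraMap (Coef Γ) (Hecke cs φ) (ex γ)

theorem proj_rel {a b : FreeAlgebra (Coef Γ) W} (h : HeckeRel cs φ a b) :
    proj cs φ a = proj cs φ b := RingQuot.mkAlgHom_rel (Coef Γ) h

theorem T_one : T cs φ 1 = 1 := by
  have := proj_rel cs φ HeckeRel.one
  rwa [map_one] at this

theorem T_mul (w w' : W) (h : cs.length (w * w') = cs.length w + cs.length w') :
    T cs φ w * T cs φ w' = T cs φ (w * w') := by
  have := proj_rel cs φ (HeckeRel.mul w w' h)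
  rwa [map_mul] at this

theorem T_quad (i : B) :
    (T cs φ (cs.simple i) - exH cs φ (φ (cls cs i))) *
      (T cs φ (cs.simple i) + exH cs φ (-φ (cls cs i))) = 0 := by
  have := proj_rel cs φ (HeckeRel.quad i)
  rwa [map_mul, map_sub, map_add, map_zero, AlgHom.commutes, AlgHom.commutes] at this

theorem exH_mul_neg (γ : Γ) : exH cs φ γ * exH cs φ (-γ) = 1 := by
  rw [exH, exH, ← map_mul, ← ex_add, add_neg_cancel, ex_zero, map_one]

theorem exH_commute (γ : Γ) (h : Hecke cs φ) : exH cs φ γ * h = h * exH cs φ γ :=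
  Algebra.commutes _ _

theorem T_simple_mul (i : B) :
    T cs φ (cs.simple i) *
      (T cs φ (cs.simple i) - exH cs φ (φ (cls cs i)) + exH cs φ (-φ (cls cs i))) = 1 := by
  have h := T_quad cs φ i
  have h1 := exH_mul_neg cs φ (φ (cls cs i))
  have h2 := exH_commute cs φ (φ (cls cs i)) (T cs φ (cs.simple i))
  rw [sub_mul, mul_add, mul_add, h1, h2] at h
  rw [mul_add, mul_sub]
  rw [← sub_eq_zero, ← h]
  abel

theorem T_simple_mul_left (i : B) :
    (T cs φ (cs.simple i) - exH cs φ (φ (cls cs i)) + exH cs φ (-φ (cls cs i))) *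
      T cs φ (cs.simple i) = 1 := by
  rw [← T_simple_mul cs φ i, add_mul, sub_mul, mul_add, mul_sub, exH_commute, exH_commute]

theorem isUnit_T_simple (i : B) : IsUnit (T cs φ (cs.simple i)) :=
  ⟨⟨_, _, T_simple_mul cs φ i, T_simple_mul_left cs φ i⟩, rfl⟩

theorem isUnit_T (w : W) : IsUnit (T cs φ w) := by
  induction hn : cs.length w generalizing w with
  | zero =>
    rw [cs.length_eq_zero_iff] at hn
    rw [hn, T_one]
    exact isUnit_one
  | succ n ih =>
    have hw : w ≠ 1 := by
      rintro rfl
      simp at hn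
    obtain ⟨i, hi⟩ := cs.exists_leftDescent_of_ne_one hw
    rw [cs.isLeftDescent_iff] at hi
    have h1 : cs.length (cs.simple i * w) = n := by omega
    have h2 := T_mul cs φ (cs.simple i) (cs.simple i * w) (by
      rw [cs.simple_mul_simple_cancel_left, cs.length_simple]
      omega)
    rw [cs.simple_mul_simple_cancel_left] at h2
    rw [← h2]
    exact (isUnit_T_simple cs φ i).mul (ih _ h1)

/-- The inverse of `T_w`. -/
def Tinv (w : W) : Hecke cs φ := ↑((isUnit_T cs φ w).unit⁻¹)

theorem Tinv_mul (w : W) : Tinv cs φ w * T cs φ w = 1 := (isUnit_T cs φ w).val_inv_mul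

theorem mul_Tinv (w : W) : T cs φ w * Tinv cs φ w = 1 := (isUnit_T cs φ w).mul_val_inv

theorem Tinv_eq {w : W} {h : Hecke cs φ} (hh : T cs φ w * h = 1) : Tinv cs φ w = h :=
  left_inv_eq_right_inv (Tinv_mul cs φ w) hh

/-- The ring `Hecke cs φ`, as an algebra over `ℤ[Γ]` through `e^γ ↦ e^(-γ)`. -/
def Twist : Type _ := Hecke cs φ

instance : Ring (Twist cs φ) := inferInstanceAs (Ring (Hecke cs φ))

instance : Algebra (Coef Γ) (Twist cs φ) :=
  RingHom.toAlgebra' (S := Twist cs φ) ((algebraMap (Coef Γ) (Hecke cs φ)).comp barCoef)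
    fun r h => Algebra.commutes (A := Hecke cs φ) (barCoef r) h

/-- The antilinear ring morphism on the free algebra sending the generator `w` to the inverse of
`T_{w⁻¹}`. -/
def barFree : FreeAlgebra (Coef Γ) W →+* Hecke cs φ :=
  (FreeAlgebra.lift (Coef Γ) (A := Twist cs φ) fun w => Tinv cs φ w⁻¹).toRingHom

theorem barFree_ι (w : W) : barFree cs φ (FreeAlgebra.ι (Coef Γ) w) = Tinv cs φ w⁻¹ :=
  FreeAlgebra.lift_ι_apply (A := Twist cs φ) _ w

theorem barFree_algebraMap (r : Coef Γ) :
    barFree cs φ (algebraMap (Coef Γ) _ r) = algebraMap (Coef Γ) (Hecke cs φ) (barCoef r) :=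
  (FreeAlgebra.lift (Coef Γ) (A := Twist cs φ) fun w => Tinv cs φ w⁻¹).commutes r

theorem barFree_rel ⦃a b : FreeAlgebra (Coef Γ) W⦄ (h : HeckeRel cs φ a b) :
    barFree cs φ a = barFree cs φ b := by
  induction h with
  | one =>
    rw [barFree_ι, map_one]
    exact Tinv_eq cs φ (by rw [inv_one, T_one, one_mul])
  | mul w w' h =>
    rw [map_mul, barFree_ι, barFree_ι, barFree_ι]
    symm
    apply Tinv_eq
    have h1 : cs.length (w'⁻¹ * w⁻¹) = cs.length w'⁻¹ + cs.length w⁻¹ := by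
      rw [← mul_inv_rev, cs.length_inv, cs.length_inv, cs.length_inv, h, add_comm]
    rw [mul_inv_rev, ← T_mul cs φ _ _ h1, mul_assoc, ← mul_assoc (T cs φ w⁻¹), mul_Tinv, one_mul,
      mul_Tinv]
  | quad i =>
    rw [map_mul, map_sub, map_add, map_zero, barFree_ι, barFree_algebraMap, barFree_algebraMap,
      barCoef_ex, barCoef_ex, neg_neg, cs.inv_simple, Tinv_eq cs φ (T_simple_mul cs φ i)]
    change (T cs φ (cs.simple i) - exH cs φ (φ (cls cs i)) + exH cs φ (-φ (cls cs i))
        - exH cs φ (-φ (cls cs i))) *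
      (T cs φ (cs.simple i) - exH cs φ (φ (cls cs i)) + exH cs φ (-φ (cls cs i))
        + exH cs φ (φ (cls cs i))) = 0
    rw [← T_quad cs φ i]
    congr 1 <;> abel

/-- The bar involution: the antilinear ring endomorphism of the Hecke algebra sending `T_w` to
the inverse of `T_{w⁻¹}`. -/
def bar : Hecke cs φ →+* Hecke cs φ := RingQuot.lift ⟨barFree cs φ, barFree_rel cs φ⟩

theorem bar_proj (a : FreeAlgebra (Coef Γ) W) : bar cs φ (proj cs φ a) = barFree cs φ a := by
  have h : proj cs φ a = RingQuot.mkRingHom (HeckeRel cs φ) a := by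
    rw [proj, ← RingQuot.mkAlgHom_coe (Coef Γ)]
    rfl
  rw [h]
  exact RingQuot.lift_mkRingHom_apply (barFree cs φ) (barFree_rel cs φ) a

theorem bar_T (w : W) : bar cs φ (T cs φ w) = Tinv cs φ w⁻¹ := by
  rw [T, bar_proj, barFree_ι]

theorem bar_exH (γ : Γ) : bar cs φ (exH cs φ γ) = exH cs φ (-γ) := by
  rw [exH, ← AlgHom.commutes (proj cs φ), bar_proj, barFree_algebraMap, barCoef_ex]
  rfl

end Hecke

/-! ## Kazhdan-Lusztig basis and cells -/

section Cells

/-- The three kinds of cells: left, right, two-sided. -/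
inductive Side
  | L | R | LR

variable {B W : Type*} [Group W] {M : CoxeterMatrix B} (cs : CoxeterSystem M W)
variable {Γ : Type*} [AddCommGroup Γ] [LinearOrder Γ] [IsOrderedAddMonoid Γ] (φ : SBar cs → Γ)

/-- The additive subgroup `⨁_w ℤ[Γ_{<0}] T_w`. -/
def heckeNeg : AddSubgroup (Hecke cs φ) :=
  AddSubgroup.closure {h | ∃ γ : Γ, γ < 0 ∧ ∃ w : W, h = ex γ • T cs φ w}

/-- `C` is bar-invariant and congruent to `T_w` modulo `⨁_w ℤ[Γ_{<0}] T_w`. -/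
def IsKL (w : W) (C : Hecke cs φ) : Prop := bar cs φ C = C ∧ C - T cs φ w ∈ heckeNeg cs φ

/-- The Kazhdan-Lusztig basis element `C_w`: the element, unique by a theorem of Lusztig, that
satisfies `IsKL`. -/
def klC (w : W) : Hecke cs φ := Classical.epsilon (IsKL cs φ w)

/-- `C_x` has a non-zero coefficient in the decomposition of `h` in the Kazhdan-Lusztig basis. -/
def Occurs (x : W) (h : Hecke cs φ) : Prop :=
  ∃ c : W →₀ Coef Γ, Finsupp.linearCombination (Coef Γ) (klC cs φ) c = h ∧ c x ≠ 0

/-- The relation `x ← y` that generates the Kazhdan-Lusztig preorder. -/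
def Arrow (q : Side) (x y : W) : Prop :=
  match q with
  | .L => ∃ h : Hecke cs φ, Occurs cs φ x (h * klC cs φ y)
  | .R => ∃ h : Hecke cs φ, Occurs cs φ x (klC cs φ y * h)
  | .LR => ∃ h : Hecke cs φ, Occurs cs φ x (h * klC cs φ y) ∨ Occurs cs φ x (klC cs φ y * h)

/-- The Kazhdan-Lusztig preorder. Since `x ← x` (take `h = 1`), the transitive closure of `←` is
also its reflexive transitive closure. -/
def KLle (q : Side) : W → W → Prop := Relation.ReflTransGen (Arrow cs φ q)

/-- The equivalence relation whose classes are the cells. -/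
def sim (q : Side) : Setoid W where
  r x y := KLle cs φ q x y ∧ KLle cs φ q y x
  iseqv :=
    { refl := fun _ => ⟨.refl, .refl⟩
      symm := fun h => ⟨h.2, h.1⟩
      trans := fun h h' => ⟨h.1.trans h'.1, h'.2.trans h.2⟩ }

/-- The cell of `w`. -/
def Cell (q : Side) (w : W) : Set W := {x | sim cs φ q x w}

/-- The free abelian group on the set of classes of simple reflections. -/
abbrev Lat : Type _ := SBar cs →₀ ℤ

/-- The canonical map from classes of simple reflections to `Γ_X`. -/
def phiX (X : PositiveSubset (Lat cs)) : SBar cs → X.Gam :=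
  fun ω => X.can (Finsupp.single ω 1)

/-- The equivalence relation attached to a positive subset `X`. -/
def simX (q : Side) (X : PositiveSubset (Lat cs)) : Setoid W := sim cs (phiX cs X) q

/-- The cell of `w` attached to a positive subset `X`. -/
def CellX (q : Side) (w : W) (X : PositiveSubset (Lat cs)) : Set W := Cell cs (phiX cs X) q w

/-! ## The conjecture -/

/-- The rational hyperplane attached to a class of simple reflections. -/
def hypCls (ω : SBar cs) : Set (PositiveSubset (Lat cs)) := hyperplane (Finsupp.single ω 1)

/-- The standard parabolic subgroup `W_F`. -/
def parabolic (F : Set (PositiveSubset (Lat cs))) : Subgroup W :=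
  Subgroup.closure {s | ∃ i : B, s = cs.simple i ∧ F ⊆ hypCls cs (cls cs i)}

/-- `C` is stable under translation by `H`: on the left, on the right, or on both sides. -/
def StableUnder (q : Side) (H : Subgroup W) (C : Set W) : Prop :=
  match q with
  | .L => ∀ u ∈ H, ∀ x ∈ C, u * x ∈ C
  | .R => ∀ u ∈ H, ∀ x ∈ C, x * u ∈ C
  | .LR => ∀ u ∈ H, ∀ x ∈ C, u * x ∈ C ∧ x * u ∈ C

/-- `C` is a union of equivalence classes of `r`. -/
def IsUnionOfClasses (r : Setoid W) (C : Set W) : Prop := ∃ 𝒟 ⊆ r.classes, C = ⋃₀ 𝒟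

/-- `C` is a union of cells for every chamber whose closure contains the facet `F` (the relation of
a chamber is that of any of its elements), and is stable under translation by `W_F`. -/
def CellCondition (𝔄 : Set (Set (PositiveSubset (Lat cs)))) (q : Side)
    (F : Set (PositiveSubset (Lat cs))) (C : Set W) : Prop :=
  (∀ D : Set (PositiveSubset (Lat cs)), IsChamber 𝔄 D → F ⊆ closure D →
    ∀ Y ∈ D, IsUnionOfClasses (simX cs q Y) C) ∧
  StableUnder q (parabolic cs F) C

/-- Conjecture A for `(W, S)`, `S` being finite: there is a finite complete rational hyperplane
arrangement such that the equivalence relation of `X` depends only on the facet of `X`, and such that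
the cells for a facet are the minimal non-empty subsets that satisfy `CellCondition`. -/
def ConjectureA : Prop :=
  ∃ 𝔄 : Set (Set (PositiveSubset (Lat cs))),
    𝔄.Finite ∧ IsArrangement 𝔄 ∧ (∀ ω : SBar cs, hypCls cs ω ∈ 𝔄) ∧
    ∀ q : Side,
      (∀ F, IsFacet 𝔄 F → ∀ X ∈ F, ∀ Y ∈ F, simX cs q X = simX cs q Y) ∧
      (∀ F, IsFacet 𝔄 F → ∀ X ∈ F, ∀ C : Set W,
        C ∈ (simX cs q X).classes ↔
          Minimal (fun C' : Set W => C'.Nonempty ∧ CellCondition cs 𝔄 q F C') C)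

end Cells

end KLCells

end

/-!
Record a positive subset `X` by its signs: the sign of `a` is that of its image in `Γ_X`, and a
facet is the set of all `Y` with prescribed signs on the arrangement. A non-zero sign is an open
condition, and two elements with the same hyperplane are proportional up to torsion, so every `Y`
near `X` keeps all the non-zero signs of `X` on a finite arrangement. The facet of `X` then lies
in the closure of the facet of `Y`: for `Z` in the former, breaking the ties of `Z` by `Y` gives a
member of the latter that belongs to every neighbourhood of `Z`. Hence conditions (b1) and (b2)
for the facet of `X` imply those for the facet of `Y`. If `C` is a cell of `X` and `C'` is a cell
of `Y` that meets it, then `C ∩ C'` satisfies the conditions for the facet of `Y`, and the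
minimality of `C'` gives `C' ⊆ C`.
-/

namespace KLCells

section Positive

variable {Λ : Type*} [AddCommGroup Λ]

namespace PositiveSubset

variable (X : PositiveSubset Λ) (a : Λ)

/-- The sign of `a` in the totally ordered group `Γ_X`. The three parts into which a rational
hyperplane cuts the space of positive subsets are where this sign is `-1`, `0` and `1`. -/
noncomputable def sgn : SignType := SignType.sign (X.can a)

variable {a}

theorem sgn_nonneg_iff : 0 ≤ X.sgn a ↔ a ∈ X.carrier := by
  rw [sgn, sign_nonneg_iff, ← map_zero X.can, can_le_can, sub_zero]

variable (a)

theorem sgn_zsmul (n : ℤ) : X.sgn (n • a) = SignType.sign n * X.sgn a := by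
  have sgn_zsmul_of_pos {m : ℤ} (hm : 0 < m) : X.sgn (m • a) = X.sgn a := by
    rw [sgn, map_zsmul]
    exact (zsmul_strictMono_right X.Gam hm).sign_comp (f := zsmulAddGroupHom m) _
  rcases lt_trichotomy n 0 with hn | rfl | hn
  · rw [sign_neg hn, neg_one_mul, ← sgn_zsmul_of_pos (neg_pos.2 hn), sgn, sgn, neg_smul, map_neg,
      Left.sign_neg, neg_neg]
  · simp [sgn]
  · rw [sign_pos hn, one_mul, sgn_zsmul_of_pos hn]

theorem sgn_neg : X.sgn (-a) = -X.sgn a := by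
  simpa using X.sgn_zsmul a (-1)

theorem sgn_zero : X.sgn 0 = 0 := by
  simpa using X.sgn_zsmul 0 0

variable {X a}

theorem sgn_eq_iff {t : SignType} :
    X.sgn a = t ↔ (a ∈ X.carrier ↔ 0 ≤ t) ∧ (-a ∈ X.carrier ↔ 0 ≤ -t) := by
  simp only [← sgn_nonneg_iff, sgn_neg]
  generalize X.sgn a = s
  decide +revert

/-- The positive subset given by a submonoid `S` with `Λ = S ∪ (-S)`; that `S ∩ (-S)` is a subgroup
is automatic. -/
def ofAddSubmonoid (S : AddSubmonoid Λ) (hS : S.IsSpanning) : PositiveSubset Λ where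
  carrier := S
  union_neg := hS.mem_or_neg_mem
  add_mem _ ha _ hb := S.add_mem ha hb
  inter_neg := ⟨S.support, rfl⟩

/-- The positive subset of the elements on which a morphism to a totally ordered group is
nonnegative. -/
def ofHom {Γ : Type*} [AddCommGroup Γ] [LinearOrder Γ] [IsOrderedAddMonoid Γ] (f : Λ →+ Γ) :
    PositiveSubset Λ :=
  ofAddSubmonoid ((AddSubmonoid.nonneg Γ).comap f) fun a => by
    simpa using le_total 0 (f a)

theorem sgn_ofHom {Γ : Type*} [AddCommGroup Γ] [LinearOrder Γ] [IsOrderedAddMonoid Γ]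
    (f : Λ →+ Γ) (a : Λ) : (ofHom f).sgn a = SignType.sign (f a) := by
  rw [sgn_eq_iff, ← Left.sign_neg, sign_nonneg_iff, sign_nonneg_iff, ← map_neg]
  exact ⟨Iff.rfl, Iff.rfl⟩

/-- The lexicographic refinement of `Y` by `X`: signs are those of `Y`, ties being broken by `X`.
On sign vectors this is the composition of covectors of an oriented matroid. -/
def lex (Y X : PositiveSubset Λ) : PositiveSubset Λ :=
  ofAddSubmonoid
    { carrier := {a | a ∈ Y.carrier ∧ (-a ∈ Y.carrier → a ∈ X.carrier)}
      zero_mem' := ⟨Y.zero_mem, fun _ => X.zero_mem⟩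
      add_mem' := by
        rintro a b ⟨ha, ha'⟩ ⟨hb, hb'⟩
        refine ⟨Y.add_mem a ha b hb, fun h => X.add_mem a (ha' ?_) b (hb' ?_)⟩
        · simpa using Y.add_mem _ h _ hb
        · simpa using Y.add_mem _ h _ ha }
    fun a => by
      have hY := Y.union_neg a
      have hX := X.union_neg a
      simp only [AddSubmonoid.mem_mk, AddSubsemigroup.mem_mk, mem_ofPred_eq, neg_neg]
      tauto

theorem lex_carrier_subset (Y X : PositiveSubset Λ) : (Y.lex X).carrier ⊆ Y.carrier :=
  fun _ ha => ha.1

theorem sgn_lex (Y X : PositiveSubset Λ) (a : Λ) :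
    (Y.lex X).sgn a = if Y.sgn a = 0 then X.sgn a else Y.sgn a := by
  have mem_lex (b : Λ) :
      b ∈ (Y.lex X).carrier ↔ b ∈ Y.carrier ∧ (-b ∈ Y.carrier → b ∈ X.carrier) := Iff.rfl
  simp only [sgn_eq_iff, mem_lex, ← sgn_nonneg_iff, sgn_neg, neg_neg]
  generalize Y.sgn a = s, X.sgn a = t
  decide +revert

end PositiveSubset

theorem U_singleton (a : Λ) : U {a} = {X : PositiveSubset Λ | X.sgn a = -1} := by
  ext X
  rw [mem_ofPred_eq, ← SignType.neg_iff, ← not_le, X.sgn_nonneg_iff]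
  simp [U]

theorem U_singleton_neg (a : Λ) : U {-a} = {X : PositiveSubset Λ | X.sgn a = 1} := by
  simp only [U_singleton, PositiveSubset.sgn_neg, neg_inj]

theorem mem_hyperplane_iff_sgn {a : Λ} {X : PositiveSubset Λ} :
    X ∈ hyperplane a ↔ X.sgn a = 0 := by
  simp [PositiveSubset.sgn_eq_iff, hyperplane]

theorem isOpen_U {E : Set Λ} (hE : E.Finite) : IsOpen (U E) :=
  fun _ hX => ⟨E, hE, hX, subset_rfl⟩

theorem U_anti {X Y : PositiveSubset Λ} (h : Y.carrier ⊆ X.carrier) {E : Set Λ} (hX : X ∈ U E) :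
    Y ∈ U E :=
  subset_empty_iff.1 ((inter_subset_inter_left E h).trans (subset_of_eq hX))

theorem specializes_of_carrier_subset {X Y : PositiveSubset Λ} (h : Y.carrier ⊆ X.carrier) :
    Y ⤳ X := by
  refine specializes_iff_forall_open.2 fun V hV hX => ?_
  obtain ⟨E, -, hXE, hEV⟩ := hV X hX
  exact hEV (U_anti h hXE)

theorem isOpen_sgn_eq (a : Λ) {t : SignType} (ht : t ≠ 0) :
    IsOpen {X : PositiveSubset Λ | X.sgn a = t} := by
  rcases t.trichotomy with rfl | rfl | rfl
  · exact U_singleton a ▸ isOpen_U (finite_singleton a)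
  · exact absurd rfl ht
  · exact U_singleton_neg a ▸ isOpen_U (finite_singleton (-a))

theorem eventually_sgn_eq (a : Λ) (X : PositiveSubset Λ) :
    ∀ᶠ Y in 𝓝 X, X.sgn a ≠ 0 → Y.sgn a = X.sgn a := by
  by_cases ha : X.sgn a = 0
  · exact .of_forall fun _ h => absurd ha h
  · filter_upwards [(isOpen_sgn_eq a ha).mem_nhds rfl] with Y hY _ using hY

theorem isClosed_hyperplane (a : Λ) : IsClosed (hyperplane a) := by
  rw [← isOpen_compl_iff, isOpen_iff_eventually]
  intro X hX
  rw [mem_compl_iff, mem_hyperplane_iff_sgn] at hX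
  filter_upwards [eventually_sgn_eq a X] with Y hY
  rwa [mem_compl_iff, mem_hyperplane_iff_sgn, hY hX]

open TensorProduct in
theorem exists_addMonoidHom_rat_of_forall_zsmul_ne {a b : Λ}
    (h : ∀ m n : ℤ, 0 < m → m • b ≠ n • a) : ∃ f : Λ →+ ℚ, f a = 0 ∧ f b ≠ 0 := by
  let ι : Λ →ₗ[ℤ] ℚ ⊗[ℤ] Λ := TensorProduct.mk ℤ ℚ Λ 1
  have not_mem_span : ι b ∉ Submodule.span ℚ {ι a} := by
    intro hspan
    obtain ⟨q, hq⟩ := Submodule.mem_span_singleton.1 hspan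
    have hι : ι ((q.den : ℤ) • b) = ι (q.num • a) := by
      rw [map_zsmul, map_zsmul, ← hq, ← Int.cast_smul_eq_zsmul ℚ, ← Int.cast_smul_eq_zsmul ℚ,
        smul_smul, Int.cast_natCast, Rat.den_mul_eq_num]
    have : IsLocalizedModule (nonZeroDivisors ℤ) ι :=
      IsLocalization.tensorProduct_isLocalizedModule _ ℚ
    obtain ⟨⟨c, hc⟩, hcab⟩ := (IsLocalizedModule.eq_iff_exists (nonZeroDivisors ℤ) ι).1 hι
    have hc0 : c ≠ 0 := nonZeroDivisors.ne_zero hc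
    have hcab : c • (q.den : ℤ) • b = c • q.num • a := hcab
    refine h (c * c * q.den) (c * c * q.num) (mul_pos (mul_self_pos.2 hc0) (mod_cast q.den_pos)) ?_
    rw [mul_smul, mul_smul, hcab, ← mul_smul, ← mul_smul]
  obtain ⟨f, hfb, hfa⟩ := Submodule.exists_le_ker_of_notMem not_mem_span
  exact ⟨f.toAddMonoidHom.comp ι.toAddMonoidHom, hfa (Submodule.mem_span_singleton_self _), hfb⟩

theorem exists_zsmul_eq_zsmul_of_hyperplane_eq {a b : Λ} (h : hyperplane a = hyperplane b) :
    ∃ m n : ℤ, 0 < m ∧ m • b = n • a := by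
  by_contra! hne
  obtain ⟨f, hfa, hfb⟩ := exists_addMonoidHom_rat_of_forall_zsmul_ne hne
  have mem_iff (c : Λ) : PositiveSubset.ofHom f ∈ hyperplane c ↔ f c = 0 := by
    rw [mem_hyperplane_iff_sgn, PositiveSubset.sgn_ofHom, sign_eq_zero_iff]
  exact hfb ((mem_iff b).1 (h ▸ (mem_iff a).2 hfa))

theorem sgn_eq_or_eq_neg_of_hyperplane_eq {a b : Λ} (h : hyperplane a = hyperplane b) :
    (∀ X : PositiveSubset Λ, X.sgn b = X.sgn a) ∨
      ∀ X : PositiveSubset Λ, X.sgn b = -X.sgn a := by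
  obtain ⟨m, n, hm, hmn⟩ := exists_zsmul_eq_zsmul_of_hyperplane_eq h
  have sgn_b (X : PositiveSubset Λ) : X.sgn b = SignType.sign n * X.sgn a := by
    rw [← X.sgn_zsmul a n, ← hmn, X.sgn_zsmul, sign_pos hm, one_mul]
  rcases lt_trichotomy n 0 with hn | rfl | hn
  · right; simpa only [sign_neg hn, neg_one_mul] using sgn_b
  · left
    intro X
    have hb : X.sgn b = 0 := by simpa only [sign_zero, zero_mul] using sgn_b X
    rw [hb, eq_comm, ← mem_hyperplane_iff_sgn, h, mem_hyperplane_iff_sgn, hb]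
  · left; simpa only [sign_pos hn, one_mul] using sgn_b

variable {𝔄 : Set (Set (PositiveSubset Λ))} {X Y : PositiveSubset Λ}

theorem eventually_forall_sgn_eq (h𝔄 : 𝔄.Finite) (X : PositiveSubset Λ) :
    ∀ᶠ Y in 𝓝 X, ∀ a, hyperplane a ∈ 𝔄 → X.sgn a ≠ 0 → Y.sgn a = X.sgn a := by
  have on_each_hyperplane : ∀ᶠ Y in 𝓝 X, ∀ P ∈ 𝔄, ∀ b, hyperplane b = P →
      X.sgn b ≠ 0 → Y.sgn b = X.sgn b := by
    refine (Filter.eventually_all_finite h𝔄).2 fun P _ => ?_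
    by_cases hP : ∃ a : Λ, hyperplane a = P
    · obtain ⟨a, rfl⟩ := hP
      filter_upwards [eventually_sgn_eq a X] with Y hY b hb
      rcases sgn_eq_or_eq_neg_of_hyperplane_eq hb.symm with h | h <;>
        simpa only [h, ne_eq, SignType.neg_eq_zero_iff, neg_inj] using hY
    · exact .of_forall fun _ a ha => absurd ⟨a, ha⟩ hP
  filter_upwards [on_each_hyperplane] with Y hY a ha using hY _ ha a rfl

theorem facetSetoid_iff_sgn :
    facetSetoid 𝔄 X Y ↔ ∀ a, hyperplane a ∈ 𝔄 → X.sgn a = Y.sgn a := by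
  have sameSide_iff (a : Λ) : (X ∈ U {a} ↔ Y ∈ U {a}) ∧ (X ∈ hyperplane a ↔ Y ∈ hyperplane a) ∧
      (X ∈ U {-a} ↔ Y ∈ U {-a}) ↔ X.sgn a = Y.sgn a := by
    simp only [U_singleton, PositiveSubset.sgn_neg, mem_hyperplane_iff_sgn, mem_ofPred_eq]
    generalize X.sgn a = s, Y.sgn a = t
    decide +revert
  constructor
  · intro h a ha
    obtain rfl | ha0 := eq_or_ne a 0
    · rw [X.sgn_zero, Y.sgn_zero]
    · exact (sameSide_iff a).1 (h _ ha a ha0 rfl)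
  · rintro h _ hP a - rfl
    exact (sameSide_iff a).2 (h a hP)

/-- The facet of the arrangement `𝔄` that contains `X`. -/
def facet (𝔄 : Set (Set (PositiveSubset Λ))) (X : PositiveSubset Λ) : Set (PositiveSubset Λ) :=
  {Y | facetSetoid 𝔄 Y X}

theorem isFacet_facet (𝔄 : Set (Set (PositiveSubset Λ))) (X : PositiveSubset Λ) :
    IsFacet 𝔄 (facet 𝔄 X) :=
  Setoid.mem_classes _ X

theorem mem_facet_self (𝔄 : Set (Set (PositiveSubset Λ))) (X : PositiveSubset Λ) :
    X ∈ facet 𝔄 X :=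
  (facetSetoid 𝔄).refl' X

theorem facet_subset_closure_facet
    (h : ∀ a, hyperplane a ∈ 𝔄 → X.sgn a ≠ 0 → Y.sgn a = X.sgn a) :
    facet 𝔄 X ⊆ closure (facet 𝔄 Y) := by
  intro Z hZ
  have sgn_Z := facetSetoid_iff_sgn.1 hZ
  have lex_mem : Z.lex Y ∈ facet 𝔄 Y := facetSetoid_iff_sgn.2 fun a ha => by
    rw [PositiveSubset.sgn_lex, sgn_Z a ha]
    split_ifs with hXa
    · rfl
    · exact (h a ha hXa).symm
  have lex_specializes : Z.lex Y ⤳ Z := specializes_of_carrier_subset (Z.lex_carrier_subset Y)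
  exact lex_specializes.mem_closed isClosed_closure (subset_closure lex_mem)

theorem eventually_facet_subset_closure_facet (h𝔄 : 𝔄.Finite) (X : PositiveSubset Λ) :
    ∀ᶠ Y in 𝓝 X, facet 𝔄 X ⊆ closure (facet 𝔄 Y) :=
  (eventually_forall_sgn_eq h𝔄 X).mono fun _ => facet_subset_closure_facet

end Positive

section Cells

theorem isUnionOfClasses_iff {α : Type*} {r : Setoid α} {C : Set α} :
    IsUnionOfClasses r C ↔ ∀ x ∈ C, ∀ y, r y x → y ∈ C := by
  constructor
  · rintro ⟨𝒟, h𝒟, rfl⟩ x ⟨D, hD, hx⟩ y hyx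
    obtain ⟨z, rfl⟩ := h𝒟 hD
    exact ⟨_, hD, r.trans' hyx hx⟩
  · refine fun h => ⟨{D | D ∈ r.classes ∧ D ⊆ C}, fun D hD => hD.1, subset_antisymm ?_ ?_⟩
    · exact fun x hx => ⟨_, ⟨r.mem_classes x, fun y => h x hx y⟩, r.refl' x⟩
    · exact sUnion_subset fun D hD => hD.2

theorem IsUnionOfClasses.inter {α : Type*} {r : Setoid α} {C D : Set α}
    (hC : IsUnionOfClasses r C) (hD : IsUnionOfClasses r D) : IsUnionOfClasses r (C ∩ D) := by
  rw [isUnionOfClasses_iff] at *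
  exact fun x hx y hy => ⟨hC x hx.1 y hy, hD x hx.2 y hy⟩

theorem setoid_le_of_minimal_classes {α : Type*} {r s : Setoid α} {p : Set α → Prop}
    (inter : ∀ ⦃C D⦄, p C → p D → p (C ∩ D)) (hr : ∀ C ∈ r.classes, p C)
    (hs : ∀ C ∈ s.classes, Minimal (fun C => C.Nonempty ∧ p C) C) : s ≤ r := by
  intro x y hxy
  have hC := hr _ (r.mem_classes y)
  have hD := hs _ (s.mem_classes y)
  have subset_inter : {z | s z y} ⊆ {z | r z y} ∩ {z | s z y} :=
    hD.le_of_le ⟨⟨y, r.refl' y, s.refl' y⟩, inter hC hD.prop.2⟩ inter_subset_right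
  exact (subset_inter hxy).1

section StableUnder

variable {W : Type*} [Group W] {q : Side} {H K : Subgroup W} {C D : Set W}

theorem StableUnder.mono (h : StableUnder q K C) (hHK : H ≤ K) : StableUnder q H C := by
  cases q <;> exact fun u hu => h u (hHK hu)

theorem StableUnder.inter (hC : StableUnder q H C) (hD : StableUnder q H D) :
    StableUnder q H (C ∩ D) := by
  cases q with
  | L | R => exact fun u hu x hx => ⟨hC u hu x hx.1, hD u hu x hx.2⟩
  | LR =>
    intro u hu x hx
    have ⟨hC_left, hC_right⟩ := hC u hu x hx.1
    have ⟨hD_left, hD_right⟩ := hD u hu x hx.2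
    exact ⟨⟨hC_left, hD_left⟩, hC_right, hD_right⟩

end StableUnder

variable {B W : Type*} [Group W] {M : CoxeterMatrix B} (cs : CoxeterSystem M W)

theorem parabolic_le_of_subset_closure {F F' : Set (PositiveSubset (Lat cs))} (h : F ⊆ closure F') :
    parabolic cs F' ≤ parabolic cs F := by
  apply Subgroup.closure_mono
  rintro s ⟨i, rfl, hi⟩
  exact ⟨i, rfl, h.trans (closure_minimal hi (isClosed_hyperplane _))⟩

variable {cs} {𝔄 : Set (Set (PositiveSubset (Lat cs)))} {q : Side}
  {F F' : Set (PositiveSubset (Lat cs))} {C C' : Set W}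

theorem CellCondition.of_subset_closure (hC : CellCondition cs 𝔄 q F C) (h : F ⊆ closure F') :
    CellCondition cs 𝔄 q F' C :=
  ⟨fun D hD hF' => hC.1 D hD (h.trans (closure_minimal hF' isClosed_closure)),
    hC.2.mono (parabolic_le_of_subset_closure cs h)⟩

theorem CellCondition.inter (hC : CellCondition cs 𝔄 q F C) (hC' : CellCondition cs 𝔄 q F C') :
    CellCondition cs 𝔄 q F (C ∩ C') :=
  ⟨fun D hD hF Y hY => (hC.1 D hD hF Y hY).inter (hC'.1 D hD hF Y hY), hC.2.inter hC'.2⟩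

variable (cs 𝔄 q) in
/-- Part (b) of Conjecture A for one arrangement `𝔄`, which may fail to be complete, and one kind
of cells. -/
def CellsAreMinimal : Prop :=
  ∀ F, IsFacet 𝔄 F → ∀ X ∈ F, ∀ C : Set W,
    C ∈ (simX cs q X).classes ↔
      Minimal (fun C' : Set W => C'.Nonempty ∧ CellCondition cs 𝔄 q F C') C

theorem CellsAreMinimal.simX_le (h : CellsAreMinimal cs 𝔄 q) {X Y : PositiveSubset (Lat cs)}
    (hXY : facet 𝔄 X ⊆ closure (facet 𝔄 Y)) : simX cs q Y ≤ simX cs q X := by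
  have minimal_of_mem_classes (Z : PositiveSubset (Lat cs)) (C : Set W) :=
    (h _ (isFacet_facet 𝔄 Z) Z (mem_facet_self 𝔄 Z) C).1
  refine setoid_le_of_minimal_classes (p := CellCondition cs 𝔄 q (facet 𝔄 Y))
    (fun _ _ => CellCondition.inter) (fun C hC => ?_) (minimal_of_mem_classes Y)
  exact (minimal_of_mem_classes X C hC).prop.2.of_subset_closure hXY

end Cells

theorem upperSemicontinuous_of_eventually_le {α β : Type*} [TopologicalSpace α] [Preorder β]
    {f : α → β} (h : ∀ x, ∀ᶠ y in 𝓝 x, f y ≤ f x) : UpperSemicontinuous f :=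
  fun x _ hx => (h x).mono fun _ hy => hy.trans_lt hx

end KLCells

theorem mainTheorem9_general {B W : Type*} [Group W] {M : CoxeterMatrix B}
    (cs : CoxeterSystem M W) {q : KLCells.Side}
    {𝔄 : Set (Set (KLCells.PositiveSubset (KLCells.Lat cs)))} (h𝔄 : 𝔄.Finite)
    (hcells : KLCells.CellsAreMinimal cs 𝔄 q) :
    UpperSemicontinuous
      (fun X : KLCells.PositiveSubset (KLCells.Lat cs) => KLCells.simX cs q X) ∧
    ∀ w : W, UpperSemicontinuous
      (fun X : KLCells.PositiveSubset (KLCells.Lat cs) => KLCells.CellX cs q w X) := by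
  have simX_le (X) : ∀ᶠ Y in 𝓝 X, KLCells.simX cs q Y ≤ KLCells.simX cs q X :=
    (KLCells.eventually_facet_subset_closure_facet h𝔄 X).mono fun _ => hcells.simX_le
  exact ⟨KLCells.upperSemicontinuous_of_eventually_le simX_le, fun w =>
    KLCells.upperSemicontinuous_of_eventually_le fun X => (simX_le X).mono fun _ hY _ hx => hY hx⟩

theorem mainTheorem9 {B W : Type*} [Finite B] [Group W] {M : CoxeterMatrix B}
    (cs : CoxeterSystem M W) (hA : KLCells.ConjectureA cs) :
    (∀ q : KLCells.Side, UpperSemicontinuous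
      (fun X : KLCells.PositiveSubset (KLCells.Lat cs) => KLCells.simX cs q X)) ∧
    (∀ (q : KLCells.Side) (w : W), UpperSemicontinuous
      (fun X : KLCells.PositiveSubset (KLCells.Lat cs) => KLCells.CellX cs q w X)) := by
  obtain ⟨𝔄, h𝔄, -, -, h⟩ := hA
  exact forall_and.1 fun q => mainTheorem9_general cs h𝔄 (h q).2
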